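/- Let $0<q<1$ and let $a,b\in\mathbb R$ satisfy $0<aq<1$ and $bq<1$. For an integer $n\ge 0$ let $$p_n(x;a,b)={}_2\phi_1\!\left(\begin{matrix}q^{-n},\,abq^{n+1}\\ aq\end{matrix};q,qx\right)=\sum_{k=0}^n\frac{(q^{-n};q)_k\,(abq^{n+1};q)_k}{(aq;q)_k\,(q;q)_k}\,(qx)^k,\qquad (c;q)_k=\prod_{j=0}^{k-1}(1-cq^j),$$ be the little $q$-Jacobi polynomial. For a real-rooted polynomial $p$ of degree $n$ let $\lambda_1(p)\le\dots\le\lambda_n(p)$ be its zeros, repeated according to multiplicity. If these are positive, the logarithmic mesh of $p$ is $\operatorname{lmesh}p=\max_{1\le j\le n-1}\lambda_j(p)/\lambda_{j+1}(p)$ (the condition $\operatorname{lmesh}p<q$ is void when $n\le 1$). For real-rooted $p$ of degree $n$ and $r$ of degree $m$, write $p\prec r$ if either $m=n$ and $\lambda_1(p)<\lambda_1(r)<\lambda_2(p)<\lambda_2(r)<\dots<\lambda_n(p)<\lambda_n(r)$, or $m=n-1$ and $\lambda_1(p)<\lambda_1(r)<\lambda_2(p)<\dots<\lambda_{n-1}(p)<\lambda_{n-1}(r)<\lambda_n(p)$.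 Then for every $n\ge 0$ the polynomial $p_n(x;a,b)$ has degree $n$, all its zeros lie in $(0,1)$, and $\operatorname{lmesh}p_n(\cdot;a,b)<q$. Moreover, (i) $p_n(x;a,b)\prec p_{n-1}(x;qa,qb)$ if $n\ge1$; (ii) $p_n(x;a,q^2b)\prec p_n(x;q^2a,b)$. If in addition $b<0$, then (iii) $p_n(x;a,b)\prec p_n(x;a,q^2b)$. -/

import Mathlib

open Polynomial

noncomputable section

/-- The `q`-Pochhammer symbol `(a; q)_k = ∏_{j < k} (1 - a q^j)`. -/
def qPochhammer (a q : ℝ) (k : ℕ) : ℝ :=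
  ∏ j ∈ Finset.range k, (1 - a * q ^ j)

/-- The terminating basic hypergeometric series `₂φ₁(q^{-n}, α; β; q, x)`, as a polynomial in `x`. -/
def twoPhiOne (q : ℝ) (n : ℕ) (α β : ℝ) : ℝ[X] :=
  ∑ k ∈ Finset.range (n + 1),
    C (qPochhammer ((q ^ n)⁻¹) q k * qPochhammer α q k /
      (qPochhammer β q k * qPochhammer q q k)) * X ^ k

/-- The little `q`-Jacobi polynomial
`p_n(x; a, b | q) = ₂φ₁(q^{-n}, a b q^{n+1}; a q; q, q x)`. -/
def littleQJacobi (q : ℝ) (n : ℕ) (a b : ℝ) : ℝ[X] :=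
  (twoPhiOne q n (a * b * q ^ (n + 1)) (a * q)).comp (C q * X)

/-- The zeros of `p` in increasing order, repeated according to multiplicity and indexed from `0`:
`orderedZero p k` is `λ_{k+1}(p)`. It is only used for real-rooted `p` and `k < p.natDegree`
(the value is `0` beyond the last zero). -/
def orderedZero (p : ℝ[X]) (k : ℕ) : ℝ :=
  (p.roots.sort (· ≤ ·)).getD k 0

/-- `p` is a real polynomial of degree `n`, all of whose zeros are real and lie in `K`. -/
def ZerosIn (n : ℕ) (K : Set ℝ) (p : ℝ[X]) : Prop :=
  p.degree = n ∧ p.Splits ∧ ∀ x ∈ p.roots, x ∈ K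

/-- The logarithmic mesh of a polynomial with positive zeros: the maximum of the ratios
`λ_j(p) / λ_{j+1}(p)` of consecutive zeros. If `p` has fewer than two zeros there are no ratios
and the value is `0`. -/
def lmesh (p : ℝ[X]) : ℝ :=
  ⨆ j : Fin (p.natDegree - 1), orderedZero p j / orderedZero p ((j : ℕ) + 1)

/-- The class of polynomials of degree `n` with all zeros in `K` (a set of positive reals) and
logarithmic mesh smaller than `q`. -/
def MeshClass (q : ℝ) (n : ℕ) (K : Set ℝ) (p : ℝ[X]) : Prop :=
  ZerosIn n K p ∧ lmesh p < q

/-- `StrictlyInterlaces p r` is the relation `p ≺ r`: both polynomials are real-rooted and either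
they have the same degree `n` and
`λ_1(p) < λ_1(r) < λ_2(p) < λ_2(r) < ⋯ < λ_n(p) < λ_n(r)`, or
`p` has degree `n`, `r` has degree `n - 1` and
`λ_1(p) < λ_1(r) < λ_2(p) < ⋯ < λ_{n-1}(p) < λ_{n-1}(r) < λ_n(p)`. -/
def StrictlyInterlaces (p r : ℝ[X]) : Prop :=
  ∃ n m : ℕ, ZerosIn n Set.univ p ∧ ZerosIn m Set.univ r ∧
    ((m = n ∧ (∀ k < n, orderedZero p k < orderedZero r k) ∧
        ∀ k, k + 1 < n → orderedZero r k < orderedZero p (k + 1)) ∨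
     (m + 1 = n ∧
        ∀ k < m, orderedZero p k < orderedZero r k ∧ orderedZero r k < orderedZero p (k + 1)))

end

/-!
Everything is read off from sign changes. The key remark is that if the zeros `ν_1 < ν_2 < ⋯` of
`y` are positive and separated by the factor `q`, i.e. `ν_i < q ν_{i+1}`, then `q ν_i` lies between
`ν_{i-1}` and `ν_i` while `ν_i / q` lies between `ν_i` and `ν_{i+1}`; hence both `y(q ν_i)` and
`y(ν_i / q)` have signs known in advance (`IsZeroSequence.sign`).

*Mesh and degree lowering.* Write `r = p_n(·; qa, qb)`, with zeros `μ_i`, and `p = p_{n+1}(·; a, b)`.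
The raising relation
`(1 - aq) p(q x) = (1 - q x) r(x) - a q (1 - b q² x) r(q x)` (`littleQJacobi_raising`),
read at `x = μ_i`, `μ_i / q` and `1 / q`, gives the signs of `p` at `q μ_i`, `μ_i` and `1`. They
force one zero of `p` in each of `(0, q μ_1)`, `(μ_i, q μ_{i+1})` and `(μ_n, 1)`. Thus
`λ_i < q μ_i < μ_i < λ_{i+1}`, which contains the interlacing of `p` and `r` as well as the
separation `λ_i < q λ_{i+1}` needed to continue the induction on the degree
(`littleQJacobi_zeros_step`).

*Parameter shifts.* In terms of `₂φ₁(q^{-n}, α; β; q, q x)` with `α = a b q^{n+1}`, `β = a q`, one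
relation compares `β` with `β q²` for the same `α`, the other compares `α` with `α q²` for the same
`β`. In each case the second-order `q`-difference equation reduces the two shifts to an identity
`f(ν) = -c y(q ν)` at the zeros `ν` of the upper polynomial `y`, and `c > 0`: in the first case by
an elementary inequality (`shift_factor_neg`), in the second because `α < 0` makes all terms of one
sign, provided `f` is expressed through `y` rather than conversely. By the key remark `f` then
changes sign between consecutive zeros of `y` (`strictlyInterlaces_of_eval_zeros`).
-/

/-! ### Coefficients -/

theorem qPochhammer_succ (a q : ℝ) (k : ℕ) :
    qPochhammer a q (k + 1) = qPochhammer a q k * (1 - a * q ^ k) :=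
  Finset.prod_range_succ _ _

theorem qPochhammer_succ' (a q : ℝ) (k : ℕ) :
    qPochhammer a q (k + 1) = (1 - a) * qPochhammer (a * q) q k := by
  simp only [qPochhammer, Finset.prod_range_succ', pow_zero, mul_one]
  rw [mul_comm]
  congr 1
  refine Finset.prod_congr rfl fun j _ => ?_
  ring

theorem qPochhammer_shift (a q : ℝ) (k : ℕ) :
    (1 - a) * qPochhammer (a * q) q k = qPochhammer a q k * (1 - a * q ^ k) := by
  rw [← qPochhammer_succ', qPochhammer_succ]

theorem qPochhammer_pos {a q : ℝ} (hq0 : 0 < q) (hq1 : q < 1) (ha : a < 1) (k : ℕ) :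
    0 < qPochhammer a q k := by
  refine Finset.prod_pos fun j _ => ?_
  have h1 : q ^ j ≤ 1 := pow_le_one₀ hq0.le hq1.le
  have h2 : 0 < q ^ j := pow_pos hq0 j
  rcases le_total a 0 with h | h <;> nlinarith

theorem qPochhammer_inv_pow_eq_zero {q : ℝ} (hq0 : 0 < q) {n k : ℕ} (h : n < k) :
    qPochhammer ((q ^ n)⁻¹) q k = 0 := by
  refine Finset.prod_eq_zero (Finset.mem_range.2 h) ?_
  rw [inv_mul_cancel₀ (pow_pos hq0 n).ne', sub_self]

/-- The coefficient of `x ^ k` in `₂φ₁(q^{-n}, α; β; q, q x)`. -/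
noncomputable def phiCoeff (q : ℝ) (n : ℕ) (α β : ℝ) (k : ℕ) : ℝ :=
  qPochhammer ((q ^ n)⁻¹) q k * qPochhammer α q k /
      (qPochhammer β q k * qPochhammer q q k) * q ^ k

/-- The polynomial `₂φ₁(q^{-n}, α; β; q, q x)`: a little `q`-Jacobi polynomial in which the
parameters `α = a b q^{n+1}` and `β = a q` can be moved independently. -/
noncomputable def phiPoly (q : ℝ) (n : ℕ) (α β : ℝ) : ℝ[X] :=
  (twoPhiOne q n α β).comp (C q * X)

/-- This holds for every `k`: the factor `(q^{-n}; q)_k` vanishes beyond the degree, so identities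
between these polynomials can be checked on coefficients without truncation. -/
theorem coeff_phiPoly {q : ℝ} (hq0 : 0 < q) (n : ℕ) (α β : ℝ) (k : ℕ) :
    (phiPoly q n α β).coeff k = phiCoeff q n α β k := by
  rw [phiPoly, comp_C_mul_X_coeff, twoPhiOne, finsetSum_coeff]
  simp only [coeff_C_mul_X_pow]
  rw [Finset.sum_ite_eq, phiCoeff]
  split_ifs with h
  · rfl
  · rw [qPochhammer_inv_pow_eq_zero hq0 (by simpa using h)]
    simp

theorem phiCoeff_zero (q : ℝ) (n : ℕ) (α β : ℝ) : phiCoeff q n α β 0 = 1 := by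
  simp [phiCoeff, qPochhammer]

theorem natDegree_phiPoly_le {q : ℝ} (hq0 : 0 < q) (n : ℕ) (α β : ℝ) :
    (phiPoly q n α β).natDegree ≤ n := by
  rw [natDegree_le_iff_coeff_eq_zero]
  intro k hk
  rw [coeff_phiPoly hq0, phiCoeff, qPochhammer_inv_pow_eq_zero hq0 hk]
  simp

theorem eval_zero_phiPoly {q : ℝ} (hq0 : 0 < q) (n : ℕ) (α β : ℝ) :
    (phiPoly q n α β).eval 0 = 1 := by
  rw [← coeff_zero_eq_eval_zero, coeff_phiPoly hq0, phiCoeff_zero]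

theorem one_sub_mul_pow_pos {q β : ℝ} (hq0 : 0 < q) (hq1 : q < 1) (hβ : β < 1) (k : ℕ) :
    0 < 1 - β * q ^ k := by
  have h1 : q ^ k ≤ 1 := pow_le_one₀ hq0.le hq1.le
  have h2 : 0 < q ^ k := pow_pos hq0 k
  rcases le_total β 0 with h | h <;> nlinarith

/-- The hypergeometric recursion for the coefficients. -/
theorem phiCoeff_succ {q : ℝ} (hq0 : 0 < q) (hq1 : q < 1) (n : ℕ) (α : ℝ) {β : ℝ} (hβ : β < 1)
    (k : ℕ) :
    phiCoeff q n α β (k + 1) * ((1 - β * q ^ k) * (1 - q * q ^ k)) =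
      phiCoeff q n α β k * (q * (1 - (q ^ n)⁻¹ * q ^ k) * (1 - α * q ^ k)) := by
  have h1 := (qPochhammer_pos hq0 hq1 hβ k).ne'
  have h2 := (qPochhammer_pos hq0 hq1 hq1 k).ne'
  have h3 := (one_sub_mul_pow_pos hq0 hq1 hβ k).ne'
  have h4 := (one_sub_mul_pow_pos hq0 hq1 hq1 k).ne'
  simp only [phiCoeff, qPochhammer_succ]
  generalize (q ^ n)⁻¹ = A
  generalize 1 - β * q ^ k = B at *
  generalize 1 - q * q ^ k = D at *
  rw [pow_succ]
  field_simp

theorem phiCoeff_denominator_shift {q : ℝ} (hq0 : 0 < q) (hq1 : q < 1) (n : ℕ) (α : ℝ) {β : ℝ}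
    (hβ : β < 1) (hβq : β * q < 1) (k : ℕ) :
    (1 - β) * phiCoeff q n α β k = phiCoeff q n α (β * q) k * (1 - β * q ^ k) := by
  have h1 := (qPochhammer_pos hq0 hq1 hβ k).ne'
  have h2 := (qPochhammer_pos hq0 hq1 hq1 k).ne'
  have h3 := (qPochhammer_pos hq0 hq1 hβq k).ne'
  have h := qPochhammer_shift β q k
  simp only [phiCoeff]
  generalize qPochhammer (q ^ n)⁻¹ q k = A
  field_simp
  linear_combination A * qPochhammer α q k * h

theorem phiCoeff_numerator_shift (q : ℝ) (n : ℕ) (α β : ℝ) (k : ℕ) :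
    (1 - α) * phiCoeff q n (α * q) β k = phiCoeff q n α β k * (1 - α * q ^ k) := by
  have h := qPochhammer_shift α q k
  simp only [phiCoeff]
  linear_combination qPochhammer (q ^ n)⁻¹ q k / (qPochhammer β q k * qPochhammer q q k) * q ^ k * h

/-- The `q`-difference `p_{n+1}(x) - p_{n+1}(q x)` is a multiple of `x` times the polynomial of
degree `n` with parameters shifted to `α q`, `β q`; on coefficients this is an index shift. -/
theorem phiCoeff_lowering {q : ℝ} (hq0 : 0 < q) (hq1 : q < 1) (n : ℕ) (α : ℝ) {β : ℝ}
    (hβ : β < 1) (hβq : β * q < 1) (k : ℕ) :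
    (1 - β) * phiCoeff q (n + 1) α β (k + 1) * (1 - q * q ^ k) =
      q * (1 - (q ^ (n + 1))⁻¹) * (1 - α) * phiCoeff q n (α * q) (β * q) k := by
  have h2 := (qPochhammer_pos hq0 hq1 hq1 k).ne'
  have h3 := (qPochhammer_pos hq0 hq1 hβq k).ne'
  have h4 := (one_sub_mul_pow_pos hq0 hq1 hq1 k).ne'
  have h5 : (q ^ (n + 1))⁻¹ * q = (q ^ n)⁻¹ := by
    rw [pow_succ]; field_simp
  have h6 : 1 - β ≠ 0 := by linarith
  simp only [phiCoeff]
  rw [qPochhammer_succ' _ _ k, qPochhammer_succ' α, qPochhammer_succ' β, qPochhammer_succ q, h5,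
    pow_succ q k]
  generalize (q ^ (n + 1))⁻¹ = A
  field_simp

/-! ### Contiguous relations and the q-difference equation -/

/-- Changing `β q` into `β` is the operator `f(x) ↦ (f(x) - β f(q x)) / (1 - β)`. -/
theorem phiPoly_denominator_shift {q : ℝ} (hq0 : 0 < q) (hq1 : q < 1) (n : ℕ) (α : ℝ) {β : ℝ}
    (hβ : β < 1) (hβq : β * q < 1) (x : ℝ) :
    (1 - β) * (phiPoly q n α β).eval x =
      (phiPoly q n α (β * q)).eval x - β * (phiPoly q n α (β * q)).eval (q * x) := by
  have key : C (1 - β) * phiPoly q n α β =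
      phiPoly q n α (β * q) - C β * (phiPoly q n α (β * q)).comp (C q * X) := by
    ext k
    simp only [coeff_C_mul, coeff_sub, comp_C_mul_X_coeff, coeff_phiPoly hq0]
    linear_combination phiCoeff_denominator_shift hq0 hq1 n α hβ hβq k
  simpa using congrArg (eval x) key

/-- The second-order `q`-difference equation `(1 - c T)(1 - T) y = q x (1 - q^{-n} T)(1 - α T) y` of
`y = ₂φ₁(q^{-n}, α; c q; q, q x)`, where `T y(x) = y(q x)`. -/
theorem phiPoly_qDifference {q : ℝ} (hq0 : 0 < q) (hq1 : q < 1) (n : ℕ) (α : ℝ) {c : ℝ}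
    (hβ : c * q < 1) (x : ℝ) :
    (phiPoly q n α (c * q)).eval x - (1 + c) * (phiPoly q n α (c * q)).eval (q * x)
        + c * (phiPoly q n α (c * q)).eval (q * (q * x)) =
      q * x * ((phiPoly q n α (c * q)).eval x
        - ((q ^ n)⁻¹ + α) * (phiPoly q n α (c * q)).eval (q * x)
        + α * (q ^ n)⁻¹ * (phiPoly q n α (c * q)).eval (q * (q * x))) := by
  set y := phiPoly q n α (c * q) with hy
  have key : y - C (1 + c) * y.comp (C q * X) + C c * (y.comp (C q * X)).comp (C q * X) =
      C q * (X * (y - C ((q ^ n)⁻¹ + α) * y.comp (C q * X)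
        + C (α * (q ^ n)⁻¹) * (y.comp (C q * X)).comp (C q * X))) := by
    ext k
    rcases k with _ | k
    · simp only [coeff_C_mul, coeff_sub, coeff_add, comp_C_mul_X_coeff, hy, coeff_phiPoly hq0,
        coeff_X_mul_zero, phiCoeff_zero]
      ring
    · simp only [coeff_C_mul, coeff_sub, coeff_add, comp_C_mul_X_coeff, hy, coeff_phiPoly hq0,
        coeff_X_mul]
      have h := phiCoeff_succ hq0 hq1 n α hβ k
      rw [pow_succ q k]
      linear_combination h
  have := congrArg (eval x) key
  simp only [eval_add, eval_sub, eval_mul, eval_comp, eval_C, eval_X] at this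
  linear_combination this

/-- Changing `α q` back into `α`. Changing `α` into `α q` is the operator
`f(x) ↦ (f(x) - α f(q x)) / (1 - α)`, and the `q`-difference equation makes its inverse again a
first-order `q`-difference operator. -/
theorem phiPoly_numerator_unshift {q : ℝ} (hq0 : 0 < q) (hq1 : q < 1) (n : ℕ) {α c : ℝ}
    (hα : α < 1) (hβ : c * q < 1) (x : ℝ) :
    (c - α) * (phiPoly q n α (c * q)).eval x =
      α * (c - α * (q ^ n)⁻¹ * q * x) * (phiPoly q n (α * q) (c * q)).eval (q * x)
        + (c - α * (1 + c) + α ^ 2 * q * x) * (phiPoly q n (α * q) (c * q)).eval x := by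
  have key : C (c - α) * phiPoly q n α (c * q) =
      C (α * c) * (phiPoly q n (α * q) (c * q)).comp (C q * X)
      - C (α ^ 2 * (q ^ n)⁻¹ * q) * (X * (phiPoly q n (α * q) (c * q)).comp (C q * X))
      + C (c - α * (1 + c)) * phiPoly q n (α * q) (c * q)
      + C (α ^ 2 * q) * (X * phiPoly q n (α * q) (c * q)) := by
    ext k
    rcases k with _ | k
    · simp only [coeff_C_mul, coeff_sub, coeff_add, comp_C_mul_X_coeff, coeff_phiPoly hq0,
        coeff_X_mul_zero, phiCoeff_zero]
      ring
    · simp only [coeff_C_mul, coeff_sub, coeff_add, comp_C_mul_X_coeff, coeff_phiPoly hq0,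
        coeff_X_mul]
      have h1 := phiCoeff_succ hq0 hq1 n (α * q) hβ k
      have h2 := phiCoeff_numerator_shift q n α (c * q) (k + 1)
      have h3 := (one_sub_mul_pow_pos hq0 hq1 hα (k + 1)).ne'
      rw [pow_succ q k] at *
      generalize (q ^ n)⁻¹ = A at *
      apply mul_right_cancel₀ h3
      linear_combination (-(c - α)) * h2 + α ^ 2 * h1
  have := congrArg (eval x) key
  simp only [eval_add, eval_sub, eval_mul, eval_comp, eval_C, eval_X] at this
  linear_combination this

/-- The raising relation, with `q x` in place of `x` so that no division by `q` occurs. -/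
theorem phiPoly_raising {q : ℝ} (hq0 : 0 < q) (hq1 : q < 1) (n : ℕ) (α : ℝ) {β : ℝ}
    (hβ : β < 1) (hβq : β * q < 1) (x : ℝ) :
    (1 - β) * (phiPoly q (n + 1) α β).eval (q * x) =
      (1 - q * x) * (phiPoly q n (α * q) (β * q)).eval x
        - (β - α * (q ^ (n + 1))⁻¹ * q ^ 2 * x) * (phiPoly q n (α * q) (β * q)).eval (q * x) := by
  set r := phiPoly q n (α * q) (β * q) with hr
  have key : C (1 - β) * (phiPoly q (n + 1) α β).comp (C q * X) =
      r - C q * (X * r) - C β * r.comp (C q * X)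
        + C (α * (q ^ (n + 1))⁻¹ * q ^ 2) * (X * r.comp (C q * X)) := by
    ext k
    rcases k with _ | k
    · simp only [coeff_C_mul, coeff_sub, coeff_add, comp_C_mul_X_coeff, hr, coeff_phiPoly hq0,
        coeff_X_mul_zero, phiCoeff_zero]
      ring
    · simp only [coeff_C_mul, coeff_sub, coeff_add, comp_C_mul_X_coeff, hr, coeff_phiPoly hq0,
        coeff_X_mul]
      have h1 := phiCoeff_succ hq0 hq1 n (α * q) hβq k
      have h2 := phiCoeff_lowering hq0 hq1 n α hβ hβq k
      have h3 := (one_sub_mul_pow_pos hq0 hq1 hq1 k).ne'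
      have h5 : (q ^ n)⁻¹ = (q ^ (n + 1))⁻¹ * q := by
        rw [pow_succ]; field_simp
      rw [h5] at h1
      rw [pow_succ q k] at *
      generalize (q ^ (n + 1))⁻¹ = A at *
      apply mul_right_cancel₀ h3
      linear_combination q * q ^ k * h2 - h1
  have := congrArg (eval x) key
  simp only [eval_add, eval_sub, eval_mul, eval_comp, eval_C, eval_X] at this
  linear_combination this

/-! ### Zeros from sign changes -/

/-- `z 0 < ⋯ < z (n - 1)` are the zeros of `p`, which has degree `n`: all zeros are real and simple.
The values `z i` with `n ≤ i` are irrelevant. -/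
structure IsZeroSequence (p : ℝ[X]) (n : ℕ) (z : ℕ → ℝ) : Prop where
  natDegree_eq : p.natDegree = n
  roots_eq : p.roots = (Multiset.range n).map z
  lt : ∀ i j, i < j → j < n → z i < z j

namespace IsZeroSequence

variable {p : ℝ[X]} {n : ℕ} {z : ℕ → ℝ}

theorem card_roots (h : IsZeroSequence p n z) : Multiset.card p.roots = p.natDegree := by
  rw [h.roots_eq, h.natDegree_eq, Multiset.card_map, Multiset.card_range]

theorem zerosIn (h : IsZeroSequence p n z) (hp : p ≠ 0) {K : Set ℝ} (hK : ∀ i < n, z i ∈ K) :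
    ZerosIn n K p := by
  refine ⟨by rw [degree_eq_natDegree hp, h.natDegree_eq],
    splits_iff_card_roots.2 h.card_roots, fun x hx => ?_⟩
  rw [h.roots_eq, Multiset.mem_map] at hx
  obtain ⟨i, hi, rfl⟩ := hx
  exact hK i (Multiset.mem_range.1 hi)

theorem orderedZero_eq (h : IsZeroSequence p n z) {k : ℕ} (hk : k < n) :
    orderedZero p k = z k := by
  have hsort : p.roots.sort (· ≤ ·) = (List.range n).map z := by
    refine List.Perm.eq_of_pairwise' (r := (· ≤ ·)) (Multiset.pairwise_sort _ _) ?_ ?_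
    · rw [List.pairwise_map]
      refine List.Pairwise.imp_of_mem ?_ (List.pairwise_lt_range (n := n))
      intro i j _ hj hij
      exact (h.lt i j hij (List.mem_range.1 hj)).le
    · rw [← Multiset.coe_eq_coe, Multiset.sort_eq, h.roots_eq]
      rfl
  rw [orderedZero, hsort]
  simp [hk]

theorem eval_eq (h : IsZeroSequence p n z) (x : ℝ) :
    p.eval x = p.leadingCoeff * ∏ i ∈ Finset.range n, (x - z i) := by
  conv_lhs => rw [← C_leadingCoeff_mul_prod_multiset_X_sub_C h.card_roots, h.roots_eq]
  rw [Multiset.map_map, eval_mul, eval_C, eval_multiset_prod, Multiset.map_map]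
  congr 2
  refine Multiset.map_congr rfl fun i _ => ?_
  simp

theorem eval_zero (h : IsZeroSequence p n z) {i : ℕ} (hi : i < n) : p.eval (z i) = 0 := by
  rw [h.eval_eq, Finset.prod_eq_zero (Finset.mem_range.2 hi) (sub_self _), mul_zero]

/-- The sign of a polynomial with positive zeros that is positive at `0`: it is `(-1) ^ j` between
the `j`-th and the `(j+1)`-st zero. -/
theorem sign (h : IsZeroSequence p n z) (h0 : 0 < p.eval 0) (hz : ∀ i < n, 0 < z i)
    {j : ℕ} (hj : j ≤ n) {x : ℝ} (hlo : ∀ i < j, z i < x) (hhi : ∀ i, j ≤ i → i < n → x < z i) :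
    0 < (-1) ^ j * p.eval x := by
  have hprod : 0 < ∏ i ∈ Finset.range n, z i :=
    Finset.prod_pos fun i hi => hz i (Finset.mem_range.1 hi)
  have neg_prod (y : ℝ) (m : ℕ) (w : ℕ → ℝ) :
      ∏ i ∈ Finset.range m, (y - w i) = (-1) ^ m * ∏ i ∈ Finset.range m, (w i - y) := by
    rw [← Finset.card_range m, ← Finset.prod_const, Finset.card_range, ← Finset.prod_mul_distrib]
    exact Finset.prod_congr rfl fun i _ => by ring
  have e0 : p.eval 0 = p.leadingCoeff * (-1) ^ n * ∏ i ∈ Finset.range n, z i := by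
    rw [h.eval_eq, neg_prod]
    simp only [sub_zero]
    ring
  have hc : 0 < p.leadingCoeff * (-1) ^ n := by
    rw [e0] at h0
    exact pos_of_mul_pos_left h0 hprod.le
  obtain ⟨m, rfl⟩ := Nat.exists_eq_add_of_le hj
  have e1 : (-1) ^ j * p.eval x = p.leadingCoeff * (-1) ^ (j + m) *
      ((∏ i ∈ Finset.range j, (x - z i)) * ∏ i ∈ Finset.range m, (z (j + i) - x)) := by
    rw [h.eval_eq, Finset.prod_range_add, neg_prod x m, pow_add]
    ring
  rw [e1]
  refine mul_pos hc (mul_pos ?_ ?_)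
  · exact Finset.prod_pos fun i hi => sub_pos.2 (hlo i (Finset.mem_range.1 hi))
  · refine Finset.prod_pos fun i hi => sub_pos.2 (hhi _ (Nat.le_add_right _ _) ?_)
    have := Finset.mem_range.1 hi
    omega

/-- A logarithmic mesh smaller than `q` is a gap condition on consecutive zeros. -/
theorem lmesh_lt (h : IsZeroSequence p n z) (hz : ∀ i < n, 0 < z i) {q : ℝ} (hq0 : 0 < q)
    (hgap : ∀ i, i + 1 < n → z i < q * z (i + 1)) : lmesh p < q := by
  rw [lmesh]
  rcases isEmpty_or_nonempty (Fin (p.natDegree - 1)) with he | he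
  · rw [Real.iSup_of_isEmpty]
    exact hq0
  · obtain ⟨i, hi⟩ := exists_eq_ciSup_of_finite
      (f := fun j : Fin (p.natDegree - 1) => orderedZero p j / orderedZero p ((j : ℕ) + 1))
    rw [← hi]
    have hin : (i : ℕ) + 1 < n := by
      have := i.2
      have := h.natDegree_eq
      omega
    rw [h.orderedZero_eq hin, h.orderedZero_eq (by omega), div_lt_iff₀ (hz _ hin)]
    exact hgap i hin

end IsZeroSequence

/-- A polynomial of degree at most `n` that changes sign on each of `n` consecutive intervals
`(l i, u i)` has exactly one zero in each of them, and no others. -/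
theorem exists_isZeroSequence_of_sign_changes {p : ℝ[X]} {n : ℕ} (hp : p ≠ 0)
    (hdeg : p.natDegree ≤ n) {l u : ℕ → ℝ} (hlu : ∀ i < n, l i < u i)
    (hul : ∀ i, i + 1 < n → u i ≤ l (i + 1))
    (hl : ∀ i < n, 0 < (-1) ^ i * p.eval (l i)) (hu : ∀ i < n, (-1) ^ i * p.eval (u i) < 0) :
    ∃ z : ℕ → ℝ, IsZeroSequence p n z ∧ ∀ i < n, l i < z i ∧ z i < u i := by
  have hex (i : ℕ) : ∃ x, i < n → (l i < x ∧ x < u i) ∧ p.eval x = 0 := by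
    by_cases hi : i < n
    · have hcont : ContinuousOn (fun x => (-1) ^ i * p.eval x) (Set.Icc (l i) (u i)) := by
        fun_prop
      obtain ⟨x, hx, hx0⟩ := intermediate_value_Ioo' (hlu i hi).le hcont ⟨hu i hi, hl i hi⟩
      exact ⟨x, fun _ => ⟨hx, by simpa using hx0⟩⟩
    · exact ⟨0, fun h => absurd h hi⟩
  choose z hz using hex
  have hlt : ∀ i j, i < j → j < n → z i < z j := by
    intro i j hij
    induction j, hij using Nat.le_induction with
    | base =>
      intro hj
      exact ((hz i (by omega)).1.2.trans_le (hul i hj)).trans (hz _ hj).1.1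
    | succ j hij ih =>
      intro hj
      exact (ih (by omega)).trans
        (((hz j (by omega)).1.2.trans_le (hul j hj)).trans (hz _ hj).1.1)
  have hnodup : ((Multiset.range n).map z).Nodup := by
    refine Multiset.Nodup.map_on (fun i hi j hj hij => ?_) (Multiset.nodup_range n)
    rw [Multiset.mem_range] at hi hj
    rcases lt_trichotomy i j with h | h | h
    · exact absurd hij (hlt i j h hj).ne
    · exact h
    · exact absurd hij (hlt j i h hi).ne'
  have hle : (Multiset.range n).map z ≤ p.roots := by
    refine (Multiset.le_iff_subset hnodup).2 fun x hx => ?_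
    obtain ⟨i, hi, rfl⟩ := Multiset.mem_map.1 hx
    exact (mem_roots hp).2 (hz i (Multiset.mem_range.1 hi)).2
  have hcard : Multiset.card ((Multiset.range n).map z) = n := by simp
  have hroots : (Multiset.range n).map z = p.roots :=
    Multiset.eq_of_le_of_card_le hle (by rw [hcard]; exact p.card_roots'.trans hdeg)
  refine ⟨z, ⟨le_antisymm hdeg ?_, hroots.symm, hlt⟩, fun i hi => (hz i hi).1⟩
  rw [← hcard, hroots]
  exact p.card_roots'

/-- If the zeros of `y` are separated by the factor `q`, then `y(q x)` alternates in sign along the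
zeros of `y`, so a polynomial `f` that agrees there with `y(q x)` up to negative factors
interlaces `y` from below. -/
theorem strictlyInterlaces_of_eval_zeros {q : ℝ} (hq0 : 0 < q) (hq1 : q < 1) {f y : ℝ[X]} {n : ℕ}
    {z : ℕ → ℝ} (hy : IsZeroSequence y n z) (hy0 : 0 < y.eval 0) (hz : ∀ i < n, 0 < z i)
    (hgap : ∀ i, i + 1 < n → z i < q * z (i + 1)) (hf0 : 0 < f.eval 0) (hdeg : f.natDegree ≤ n)
    (hneg : ∀ i < n, ∃ c > 0, f.eval (z i) = -c * y.eval (q * z i)) :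
    StrictlyInterlaces f y := by
  have hsign : ∀ i < n, (-1) ^ i * f.eval (z i) < 0 := by
    intro i hi
    obtain ⟨c, hc, hfc⟩ := hneg i hi
    have hqi : q * z i < z i := mul_lt_of_lt_one_left (hz i hi) hq1
    have hs : 0 < (-1) ^ i * y.eval (q * z i) := by
      refine hy.sign hy0 hz hi.le (fun k hk => ?_) (fun k hk hkn => ?_)
      · have h1 := hgap k (by omega)
        have h2 : z (k + 1) ≤ z i := by
          rcases (Nat.succ_le_of_lt hk).eq_or_lt with h | h
          · exact le_of_eq (congrArg z h)
          · exact (hy.lt _ _ h hi).le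
        exact h1.trans_le (mul_le_mul_of_nonneg_left h2 hq0.le)
      · rcases hk.eq_or_lt with rfl | h
        · exact hqi
        · exact hqi.trans (hy.lt _ _ h hkn)
    rw [hfc]
    nlinarith [mul_pos hc hs]
  have hf : f ≠ 0 := by
    rintro rfl
    simp at hf0
  have hy' : y ≠ 0 := by
    rintro rfl
    simp at hy0
  obtain ⟨w, hw, hwz⟩ := exists_isZeroSequence_of_sign_changes hf hdeg
    (l := fun i => if i = 0 then 0 else z (i - 1)) (u := z)
    (by
      intro i hi
      rcases i with _ | i
      · simpa using hz 0 hi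
      · simpa using hy.lt i (i + 1) (by omega) hi)
    (by intro i _; simp)
    (by
      intro i hi
      rcases i with _ | i
      · simpa using hf0
      · have := hsign i (by omega)
        simp only [Nat.add_eq_zero_iff, one_ne_zero, and_false, if_false, Nat.add_sub_cancel,
          pow_succ]
        linarith)
    hsign
  refine ⟨n, n, hw.zerosIn hf fun _ _ => trivial, hy.zerosIn hy' fun _ _ => trivial,
    Or.inl ⟨rfl, fun k hk => ?_, fun k hk => ?_⟩⟩
  · rw [hw.orderedZero_eq hk, hy.orderedZero_eq hk]
    exact (hwz k hk).2
  · rw [hw.orderedZero_eq hk, hy.orderedZero_eq (by omega)]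
    simpa using (hwz (k + 1) hk).1

/-! ### Location of the zeros -/

theorem littleQJacobi_eq_phiPoly (q : ℝ) (n : ℕ) (a b : ℝ) :
    littleQJacobi q n a b = phiPoly q n (a * b * q ^ (n + 1)) (a * q) := rfl

theorem eval_zero_littleQJacobi {q : ℝ} (hq0 : 0 < q) (n : ℕ) (a b : ℝ) :
    (littleQJacobi q n a b).eval 0 = 1 :=
  eval_zero_phiPoly hq0 n _ _

theorem littleQJacobi_ne_zero {q : ℝ} (hq0 : 0 < q) (n : ℕ) (a b : ℝ) :
    littleQJacobi q n a b ≠ 0 := by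
  intro h
  have := eval_zero_littleQJacobi hq0 n a b
  simp [h] at this

theorem littleQJacobi_raising {q : ℝ} (hq0 : 0 < q) (hq1 : q < 1) (n : ℕ) {a : ℝ} (b : ℝ)
    (ha0 : 0 < a * q) (ha1 : a * q < 1) (x : ℝ) :
    (1 - a * q) * (littleQJacobi q (n + 1) a b).eval (q * x) =
      (1 - q * x) * (littleQJacobi q n (q * a) (q * b)).eval x
        - a * q * (1 - b * q ^ 2 * x) * (littleQJacobi q n (q * a) (q * b)).eval (q * x) := by
  have hβq : a * q * q < 1 := (mul_lt_of_lt_one_right ha0 hq1).trans ha1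
  have h := phiPoly_raising hq0 hq1 n (a * b * q ^ (n + 2)) ha1 hβq x
  have e : littleQJacobi q n (q * a) (q * b) =
      phiPoly q n (a * b * q ^ (n + 2) * q) (a * q * q) := by
    rw [littleQJacobi_eq_phiPoly]
    congr 1 <;> ring
  have e2 : a * b * q ^ (n + 2) * (q ^ (n + 1))⁻¹ = a * b * q := by
    rw [pow_succ q (n + 1)]
    field_simp
  rw [e, littleQJacobi_eq_phiPoly, h, e2]
  ring

theorem one_sub_mul_sq_mul_pos {q b x : ℝ} (hq0 : 0 < q) (hq1 : q < 1) (hb : b * q < 1)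
    (hx : x ∈ Set.Ioo (0 : ℝ) 1) : 0 < 1 - b * q ^ 2 * x := by
  have h1 : q * x < 1 := by nlinarith [hx.1, hx.2]
  have h2 : 0 < q * x := mul_pos hq0 hx.1
  nlinarith

/-- The raising relation makes `p_{n+1}(·; a, b)` change sign between a zero `μ` of
`p_n(·; q a, q b)` and `q` times the next one, because the zeros of the latter are separated by the
factor `q`. The separation is inherited: `λ_i < q μ_i < q λ_{i+1}`. -/
theorem littleQJacobi_zeros_step {q : ℝ} (hq0 : 0 < q) (hq1 : q < 1) {n : ℕ} {a b : ℝ}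
    (ha0 : 0 < a * q) (ha1 : a * q < 1) (hb : b * q < 1) {m : ℕ → ℝ}
    (hm : IsZeroSequence (littleQJacobi q n (q * a) (q * b)) n m)
    (hm01 : ∀ i < n, m i ∈ Set.Ioo (0 : ℝ) 1) (hgap : ∀ i, i + 1 < n → m i < q * m (i + 1)) :
    ∃ z, IsZeroSequence (littleQJacobi q (n + 1) a b) (n + 1) z ∧
      (∀ i < n + 1, z i ∈ Set.Ioo (0 : ℝ) 1) ∧ (∀ i < n, z i < q * m i ∧ m i < z (i + 1)) := by
  have hraise := littleQJacobi_raising hq0 hq1 n b ha0 ha1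
  have hp0 := eval_zero_littleQJacobi hq0 (n + 1) a b
  have hr0 : 0 < (littleQJacobi q n (q * a) (q * b)).eval 0 := by
    rw [eval_zero_littleQJacobi hq0]; exact one_pos
  have hdeg := natDegree_phiPoly_le hq0 (n + 1) (a * b * q ^ (n + 1 + 1)) (a * q)
  rw [← littleQJacobi_eq_phiPoly] at hdeg
  have hpne := littleQJacobi_ne_zero hq0 (n + 1) a b
  have hc : 0 < 1 - a * q := by linarith
  have hmpos : ∀ i < n, 0 < m i := fun i hi => (hm01 i hi).1
  have hmono : ∀ i j, i ≤ j → j < n → m i ≤ m j := by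
    intro i j hij hj
    rcases hij.eq_or_lt with rfl | h
    · exact le_rfl
    · exact (hm.lt i j h hj).le
  generalize littleQJacobi q n (q * a) (q * b) = r at *
  generalize littleQJacobi q (n + 1) a b = p at *
  have hzero : ∀ i < n, r.eval (m i) = 0 := fun i hi => hm.eval_zero hi
  have hlow : ∀ i < n, (-1) ^ i * p.eval (q * m i) < 0 := by
    intro i hi
    have hs : 0 < (-1) ^ i * r.eval (q * m i) := by
      have hqi : q * m i < m i := mul_lt_of_lt_one_left (hmpos i hi) hq1
      refine hm.sign hr0 hmpos hi.le (fun k hk => ?_) (fun k hk hkn => ?_)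
      · exact (hgap k (by omega)).trans_le
          (mul_le_mul_of_nonneg_left (hmono _ _ hk hi) hq0.le)
      · exact hqi.trans_le (hmono _ _ hk hkn)
    have hw : 0 < a * q * (1 - b * q ^ 2 * m i) :=
      mul_pos ha0 (one_sub_mul_sq_mul_pos hq0 hq1 hb (hm01 i hi))
    have h := hraise (m i)
    rw [hzero i hi] at h
    have := mul_pos hw hs
    have h3 : (1 - a * q) * ((-1) ^ i * p.eval (q * m i)) < 0 := by
      linear_combination this + (-1) ^ i * h
    exact neg_of_mul_neg_right h3 hc.le
  have hhigh : ∀ i < n, (-1) ^ (i + 1) * p.eval (m i) > 0 := by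
    intro i hi
    have hqi : m i < m i / q := by
      rw [lt_div_iff₀ hq0]
      nlinarith [hmpos i hi]
    have hs : 0 < (-1) ^ (i + 1) * r.eval (m i / q) := by
      refine hm.sign hr0 hmpos hi (fun k hk => ?_) (fun k hk hkn => ?_)
      · exact (hmono k i (by omega) hi).trans_lt hqi
      · rw [div_lt_iff₀' hq0]
        exact (hgap i (by omega)).trans_le (mul_le_mul_of_nonneg_left (hmono _ _ hk hkn) hq0.le)
    have h := hraise (m i / q)
    rw [mul_div_cancel₀ _ hq0.ne', hzero i hi] at h
    have := mul_pos (sub_pos.2 (hm01 i hi).2) hs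
    have h3 : 0 < (1 - a * q) * ((-1) ^ (i + 1) * p.eval (m i)) := by
      linear_combination this - (-1) ^ (i + 1) * h
    exact pos_of_mul_pos_right h3 hc.le
  have hone : (-1) ^ n * p.eval 1 < 0 := by
    have hs : 0 < (-1) ^ n * r.eval 1 :=
      hm.sign hr0 hmpos le_rfl (fun k hk => (hm01 k hk).2) fun k hk hkn => absurd hkn hk.not_gt
    have h := hraise (1 / q)
    rw [mul_div_cancel₀ _ hq0.ne', sub_self, zero_mul] at h
    have e : b * q ^ 2 * (1 / q) = b * q := by field_simp
    rw [e] at h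
    have := mul_pos (mul_pos ha0 (sub_pos.2 hb)) hs
    have h3 : (1 - a * q) * ((-1) ^ n * p.eval 1) < 0 := by
      linear_combination this + (-1) ^ n * h
    exact neg_of_mul_neg_right h3 hc.le
  obtain ⟨z, hz, hzb⟩ := exists_isZeroSequence_of_sign_changes hpne hdeg
    (l := fun i => if i = 0 then 0 else m (i - 1)) (u := fun i => if i = n then 1 else q * m i)
    (by
      intro i hi
      rcases i with _ | i
      · by_cases h : 0 = n
        · simp [h]
        · simpa [h] using mul_pos hq0 (hmpos 0 (by omega))
      · by_cases h : i + 1 = n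
        · subst h
          simpa using (hm01 i (by omega)).2
        · simpa [h] using hgap i (by omega))
    (by
      intro i hi
      have h : i ≠ n := by omega
      simpa [h] using (mul_lt_of_lt_one_left (hmpos i (by omega)) hq1).le)
    (by
      intro i hi
      rcases i with _ | i
      · simp [hp0]
      · simpa using hhigh i (by omega))
    (by
      intro i hi
      by_cases h : i = n
      · simpa [h] using hone
      · simpa [h] using hlow i (by omega))
  have hinter : ∀ i < n, z i < q * m i ∧ m i < z (i + 1) := by
    intro i hi
    have h1 := (hzb i (by omega)).2
    have h2 := (hzb (i + 1) (by omega)).1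
    rw [if_neg (by omega)] at h1
    exact ⟨h1, by simpa using h2⟩
  refine ⟨z, hz, fun i hi => ⟨?_, ?_⟩, hinter⟩
  · rcases i with _ | i
    · simpa using (hzb 0 hi).1
    · exact (hmpos i (by omega)).trans (hinter i (by omega)).2
  · by_cases h : i = n
    · simpa [h] using (hzb i hi).2
    · have hi' : i < n := by omega
      exact ((hinter i hi').1.trans (mul_lt_of_lt_one_left (hmpos i hi') hq1)).trans (hm01 i hi').2

theorem littleQJacobi_zeros {q : ℝ} (hq0 : 0 < q) (hq1 : q < 1) (n : ℕ) :
    ∀ {a b : ℝ}, 0 < a * q → a * q < 1 → b * q < 1 →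
      ∃ z, IsZeroSequence (littleQJacobi q n a b) n z ∧ (∀ i < n, z i ∈ Set.Ioo (0 : ℝ) 1) ∧
        ∀ i, i + 1 < n → z i < q * z (i + 1) := by
  induction n with
  | zero =>
    intro a b _ _ _
    obtain ⟨z, hz, -⟩ := exists_isZeroSequence_of_sign_changes (littleQJacobi_ne_zero hq0 0 a b)
      (natDegree_phiPoly_le hq0 0 _ _) (l := 0) (u := 0) (by simp) (by simp) (by simp) (by simp)
    exact ⟨z, hz, by simp, by simp⟩
  | succ n ih =>
    intro a b ha0 ha1 hb
    obtain ⟨m, hm, hm01, hgap⟩ := ih (a := q * a) (b := q * b)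
      (by rw [mul_assoc]; exact mul_pos hq0 ha0) (by nlinarith) (by nlinarith)
    obtain ⟨z, hz, hz01, hzm⟩ := littleQJacobi_zeros_step hq0 hq1 ha0 ha1 hb hm hm01 hgap
    exact ⟨z, hz, hz01, fun i hi => (hzm i (by omega)).1.trans
      (mul_lt_mul_of_pos_left (hzm i (by omega)).2 hq0)⟩

/-! ### Interlacing under parameter shifts -/

/-- At a zero of `₂φ₁(q^{-n}, α; β q²; q, q x)` the two denominator shifts and the `q`-difference
equation express `₂φ₁(q^{-n}, α; β; q, q x)` through one value of the former. -/
theorem phiPoly_eval_zero_of_denominator_shift_two {q : ℝ} (hq0 : 0 < q) (hq1 : q < 1) (n : ℕ)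
    (α : ℝ) {β : ℝ} (hβ0 : 0 < β) (hβ : β < 1) {x : ℝ}
    (hx : (phiPoly q n α (β * q * q)).eval x = 0) :
    (1 - β) * (1 - β * q) * (β * q - α * (q ^ n)⁻¹ * q * x) * (phiPoly q n α β).eval x =
      β * (β * q * (1 + β * q - q * x * ((q ^ n)⁻¹ + α))
        - (1 + q) * (β * q - α * (q ^ n)⁻¹ * q * x)) *
        (phiPoly q n α (β * q * q)).eval (q * x) := by
  have hβq : β * q < 1 := (mul_lt_of_lt_one_right hβ0 hq1).trans hβ
  have hβqq : β * q * q < 1 := (mul_lt_of_lt_one_right (mul_pos hβ0 hq0) hq1).trans hβq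
  have h1 := phiPoly_denominator_shift hq0 hq1 n α hβ hβq x
  have h2 := phiPoly_denominator_shift hq0 hq1 n α hβq hβqq x
  have h3 := phiPoly_denominator_shift hq0 hq1 n α hβq hβqq (q * x)
  have h4 := phiPoly_qDifference hq0 hq1 n α hβqq x
  rw [hx] at h2 h4
  generalize (q ^ n)⁻¹ = A at *
  linear_combination (β * q - α * A * q * x) * ((1 - β * q) * h1 + h2 - β * h3) + β ^ 2 * q * h4

/-- At a zero of `₂φ₁(q^{-n}, α q²; c q; q, q x)` the two inverse numerator shifts and the
`q`-difference equation express `₂φ₁(q^{-n}, α; c q; q, q x)` through one value of the former. -/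
theorem phiPoly_eval_zero_of_numerator_shift_two {q : ℝ} (hq0 : 0 < q) (hq1 : q < 1) (n : ℕ)
    {α c : ℝ} (hα : α < 0) (hβ : c * q < 1) {x : ℝ}
    (hx : (phiPoly q n (α * q * q) (c * q)).eval x = 0) :
    (c - α) * (c - α * q) * (phiPoly q n α (c * q)).eval x =
      α * (c - α * q * (q ^ n)⁻¹ * q * x) * ((c - α * (q ^ n)⁻¹ * q * x)
        + q * (c - α * (1 + c) + α ^ 2 * q * x)) *
        (phiPoly q n (α * q * q) (c * q)).eval (q * x) := by
  have hα1 : α < 1 := hα.trans one_pos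
  have hαq : α * q < 1 := (mul_neg_of_neg_of_pos hα hq0).trans one_pos
  have h1 := phiPoly_numerator_unshift hq0 hq1 n hα1 hβ x
  have h2 := phiPoly_numerator_unshift hq0 hq1 n hαq hβ x
  have h3 := phiPoly_numerator_unshift hq0 hq1 n hαq hβ (q * x)
  have h4 := phiPoly_qDifference hq0 hq1 n (α * q * q) hβ x
  rw [hx] at h2 h4
  generalize (q ^ n)⁻¹ = A at *
  linear_combination (c - α * q) * h1 + α * (c - α * A * q * x) * h3
    + (c - α * (1 + c) + α ^ 2 * q * x) * h2 + α ^ 2 * q * (c - α * A * q * x) * h4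

/-- With `u = a q`, `v = b q` and `w = q ^ n`, this is the sign of the factor relating
`p_n(·; a, q² b)` to `p_n(·; q² a, b)` at the zeros of the latter. The expression is affine in each
of `x`, `v` and `u`, and at `x = v = 1` it is at most `-(1 - w) (1 - q w) / w`. -/
theorem shift_factor_neg {q u v w x : ℝ} (hq0 : 0 < q) (hq1 : q < 1) (hu0 : 0 < u) (hu1 : u < 1)
    (hv : v < 1) (hw0 : 0 < w) (hw1 : w ≤ 1) (hx0 : 0 < x) (hx1 : x < 1) :
    -(1 - u) + x * (v * (1 + q) - w⁻¹ - u * v * q * w) < 0 := by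
  set M := v * (1 + q) - w⁻¹ - u * v * q * w with hM
  rcases le_or_gt M 0 with h | h
  · nlinarith
  have hwi : w⁻¹ * w = 1 := inv_mul_cancel₀ hw0.ne'
  have hqw : q * w < 1 := by nlinarith
  have hqw0 : 0 < q * w := mul_pos hq0 hw0
  have huqw : u * (q * w) < 1 := by nlinarith
  have h1 : M ≤ (1 + q) - w⁻¹ - u * q * w := by
    have : 0 ≤ (1 - v) * (1 + q - u * (q * w)) := mul_nonneg (by linarith) (by linarith)
    rw [hM]
    linear_combination this
  have h2 : 0 ≤ w⁻¹ * (1 - w) * (1 - q * w) :=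
    mul_nonneg (mul_nonneg (inv_pos.2 hw0).le (by linarith)) (by linarith)
  have h3 : w⁻¹ * (1 - w) * (1 - q * w) = w⁻¹ - 1 - q + q * w := by
    linear_combination (-1 - q + q * w) * hwi
  have h4 : x * M < M := mul_lt_of_lt_one_left h hx1
  have h5 : 0 ≤ (1 - u) * (1 - q * w) := mul_nonneg (by linarith) (by linarith)
  linear_combination h4 + h1 + h2 + h3 + h5

theorem littleQJacobi_interlaces_of_a_shift {q a b : ℝ} (hq0 : 0 < q) (hq1 : q < 1)
    (ha0 : 0 < a * q) (ha1 : a * q < 1) (hb : b * q < 1) (n : ℕ) :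
    StrictlyInterlaces (littleQJacobi q n a (q ^ 2 * b)) (littleQJacobi q n (q ^ 2 * a) b) := by
  have haq : a * q * q < 1 := (mul_lt_of_lt_one_right ha0 hq1).trans ha1
  have haqq : q ^ 2 * a * q < 1 := by nlinarith [mul_pos ha0 hq0]
  obtain ⟨z, hz, hz01, hgap⟩ := littleQJacobi_zeros hq0 hq1 n (a := q ^ 2 * a) (b := b)
    (by rw [mul_assoc]; exact mul_pos (pow_pos hq0 2) ha0) haqq hb
  refine strictlyInterlaces_of_eval_zeros hq0 hq1 hz ?_ (fun i hi => (hz01 i hi).1) hgap ?_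
    (natDegree_phiPoly_le hq0 n _ _) fun i hi => ?_
  · rw [eval_zero_littleQJacobi hq0]; exact one_pos
  · rw [eval_zero_littleQJacobi hq0]; exact one_pos
  have e1 : littleQJacobi q n a (q ^ 2 * b) = phiPoly q n (a * b * q ^ (n + 3)) (a * q) := by
    rw [littleQJacobi_eq_phiPoly]
    congr 1
    ring
  have e2 : littleQJacobi q n (q ^ 2 * a) b =
      phiPoly q n (a * b * q ^ (n + 3)) (a * q * q * q) := by
    rw [littleQJacobi_eq_phiPoly]
    congr 1 <;> ring
  have hx := hz.eval_zero hi
  have hx01 := hz01 i hi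
  rw [e2] at hx
  have h := phiPoly_eval_zero_of_denominator_shift_two hq0 hq1 n (a * b * q ^ (n + 3)) ha0 ha1 hx
  rw [e1, e2]
  have hαA : a * b * q ^ (n + 3) * (q ^ n)⁻¹ = a * b * q ^ 3 := by
    rw [pow_add]
    field_simp
  rw [hαA] at h
  have hpos := one_sub_mul_sq_mul_pos hq0 hq1 hb hx01
  have hG := shift_factor_neg hq0 hq1 ha0 ha1 hb (pow_pos hq0 n) (pow_le_one₀ hq0.le hq1.le)
    hx01.1 hx01.2
  set G := -(1 - a * q) + z i * (b * q * (1 + q) - (q ^ n)⁻¹ - a * q * (b * q) * q * q ^ n) with hGd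
  set D := (1 - a * q) * (1 - a * q * q) * (a * q * q * (1 - b * q ^ 2 * z i)) with hD
  have hDpos : 0 < D :=
    mul_pos (mul_pos (by linarith) (by linarith)) (mul_pos (mul_pos ha0 hq0) hpos)
  -- the bracket in `h` equals `a q ^ 3 * G`, because `α q^{-n} = a b q ^ 3`
  refine ⟨(a * q) ^ 2 * q ^ 2 * -G / D,
    div_pos (mul_pos (by positivity) (by linarith)) hDpos, ?_⟩
  rw [← neg_div, div_mul_eq_mul_div, eq_div_iff hDpos.ne']
  rw [hD, hGd]
  linear_combination h

theorem littleQJacobi_interlaces_of_b_shift {q a b : ℝ} (hq0 : 0 < q) (hq1 : q < 1)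
    (ha0 : 0 < a * q) (ha1 : a * q < 1) (hb : b < 0) (n : ℕ) :
    StrictlyInterlaces (littleQJacobi q n a b) (littleQJacobi q n a (q ^ 2 * b)) := by
  have ha : 0 < a := pos_of_mul_pos_left ha0 hq0.le
  have hbq : b * q < 1 := (mul_neg_of_neg_of_pos hb hq0).trans one_pos
  have hbqq : q ^ 2 * b * q < 1 :=
    (mul_neg_of_neg_of_pos (mul_neg_of_pos_of_neg (pow_pos hq0 2) hb) hq0).trans one_pos
  obtain ⟨z, hz, hz01, hgap⟩ := littleQJacobi_zeros hq0 hq1 n ha0 ha1 hbqq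
  refine strictlyInterlaces_of_eval_zeros hq0 hq1 hz ?_ (fun i hi => (hz01 i hi).1) hgap ?_
    (natDegree_phiPoly_le hq0 n _ _) fun i hi => ?_
  · rw [eval_zero_littleQJacobi hq0]; exact one_pos
  · rw [eval_zero_littleQJacobi hq0]; exact one_pos
  obtain ⟨α, hα⟩ : ∃ α, α = a * b * q ^ (n + 1) := ⟨_, rfl⟩
  have hα0 : α < 0 :=
    hα ▸ mul_neg_of_neg_of_pos (mul_neg_of_pos_of_neg ha hb) (pow_pos hq0 _)
  have e1 : littleQJacobi q n a b = phiPoly q n α (a * q) := by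
    rw [littleQJacobi_eq_phiPoly, hα]
  have e2 : littleQJacobi q n a (q ^ 2 * b) = phiPoly q n (α * q * q) (a * q) := by
    rw [littleQJacobi_eq_phiPoly]
    congr 1
    rw [hα]
    ring
  have hx := hz.eval_zero hi
  have hx0 := (hz01 i hi).1
  rw [e2] at hx
  have h := phiPoly_eval_zero_of_numerator_shift_two hq0 hq1 n hα0 ha1 hx
  rw [e1, e2]
  have hA : 0 < (q ^ n)⁻¹ := inv_pos.2 (pow_pos hq0 n)
  generalize (q ^ n)⁻¹ = A at *
  clear hα e1 e2
  obtain ⟨s, hs⟩ : ∃ s, s = -α := ⟨_, rfl⟩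
  have hs0 : 0 < s := by linarith
  obtain rfl : α = -s := by linarith
  have hD : 0 < (a - -s) * (a - -s * q) := mul_pos (by linarith) (by nlinarith)
  -- every factor is a sum of nonnegative terms once it is written in `s = -α > 0`
  have hN : 0 < s * (a + s * q * A * q * z i) *
      ((a + s * A * q * z i) + q * (a + s * (1 + a) + s ^ 2 * q * z i)) := by positivity
  refine ⟨_, div_pos hN hD, ?_⟩
  rw [← neg_div, div_mul_eq_mul_div, eq_div_iff hD.ne']
  linear_combination h

theorem theorem2 (q a b : ℝ) (hq0 : 0 < q) (hq1 : q < 1)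
    (ha0 : 0 < a * q) (ha1 : a * q < 1) (hb : b * q < 1) (n : ℕ) :
    MeshClass q n (Set.Ioo 0 1) (littleQJacobi q n a b) ∧
    (1 ≤ n →
      StrictlyInterlaces (littleQJacobi q n a b) (littleQJacobi q (n - 1) (q * a) (q * b))) ∧
    StrictlyInterlaces (littleQJacobi q n a (q ^ 2 * b)) (littleQJacobi q n (q ^ 2 * a) b) ∧
    (b < 0 →
      StrictlyInterlaces (littleQJacobi q n a b) (littleQJacobi q n a (q ^ 2 * b))) := by
  refine ⟨?_, fun hn => ?_, littleQJacobi_interlaces_of_a_shift hq0 hq1 ha0 ha1 hb n,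
    fun hb0 => littleQJacobi_interlaces_of_b_shift hq0 hq1 ha0 ha1 hb0 n⟩
  · obtain ⟨z, hz, hz01, hgap⟩ := littleQJacobi_zeros hq0 hq1 n ha0 ha1 hb
    exact ⟨hz.zerosIn (littleQJacobi_ne_zero hq0 n a b) hz01,
      hz.lmesh_lt (fun i hi => (hz01 i hi).1) hq0 hgap⟩
  · obtain ⟨n, rfl⟩ := Nat.exists_eq_add_of_le' hn
    rw [Nat.add_sub_cancel]
    obtain ⟨m, hm, hm01, hgap⟩ := littleQJacobi_zeros hq0 hq1 n (a := q * a) (b := q * b)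
      (by rw [mul_assoc]; exact mul_pos hq0 ha0) (by nlinarith) (by nlinarith)
    obtain ⟨z, hz, -, hzm⟩ := littleQJacobi_zeros_step hq0 hq1 ha0 ha1 hb hm hm01 hgap
    refine ⟨n + 1, n, hz.zerosIn (littleQJacobi_ne_zero hq0 _ _ _) fun _ _ => trivial,
      hm.zerosIn (littleQJacobi_ne_zero hq0 _ _ _) fun _ _ => trivial,
      Or.inr ⟨rfl, fun k hk => ?_⟩⟩
    rw [hz.orderedZero_eq (by omega), hz.orderedZero_eq (by omega), hm.orderedZero_eq hk]
    exact ⟨(hzm k hk).1.trans (mul_lt_of_lt_one_left (hm01 k hk).1 hq1), (hzm k hk).2⟩
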